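/- Let $p>1$, $C_0\ge 1$, $\tau_0\in(0,1)$ and $\delta>0$. There is a constant $C_1\ge 1$, depending only on $C_0,\delta,p,\tau_0$, with the following property. Let $D\ge 1$ and $r_0>0$ be such that $$\delta<\delta_{p,D}:=\tfrac12 D^{-5/p},$$ and let $(X,d)$ be a proper metric space with a Radon measure $\mu$. Write $B(x,r)$ for open balls, $g_B=\frac{1}{\mu(B)}\int_B g\,d\mu$ for averages, and $M_s g(x)=\sup_{0<r<s}g_{B(x,r)}$. Assume: 1. ($D$-doubling up to scale $r_0$) $0<\mu(B(x,2r))\le D\,\mu(B(x,r))$ for all $x\in X$ and $r\in(0,r_0)$. 2. ($(C_0,\delta,\tau_0,p)$-max connected at scale $r_0$) For all $x,y\in X$ with $r:=d(x,y)\in(0,r_0)$ and every Borel set $E\subset X$ with $M_{C_0r}1_E(x)<\tau_0$ and $M_{C_0r}1_E(y)<\tau_0$ there is a $1$-Lipschitz curve $\gamma:[0,L]\to X$, $L>0$, with $\gamma(0)=x$, $\gamma(L)=y$, $\mathrm{Len}(\gamma)\le C_0r$ and $\int_\gamma 1_E\,ds\le\delta\,\tau_0^{1/p}\,r$. Then $X$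 satisfies a $(1,p)$-Poincaré inequality at scale $r_0/(10C_0)$ with constant $C_1$ and dilation factor $10C_0$: for every Lipschitz $f:X\to\mathbb R$, every $x\in X$ and every $0<r<r_0/(10C_0)$, $$\frac{1}{\mu(B(x,r))}\int_{B(x,r)}|f-f_{B(x,r)}|\,d\mu\;\le\; C_1\,r\left(\frac{1}{\mu(B(x,10C_0r))}\int_{B(x,10C_0r)}\mathrm{Lip}[f]^p\,d\mu\right)^{1/p},$$ where $\mathrm{Lip}[f](x)=\limsup_{y\to x}\frac{|f(x)-f(y)|}{d(x,y)}$. -/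

import Mathlib

open MeasureTheory Set Filter Topology
open scoped ENNReal NNReal

noncomputable section

namespace MaxConn

/-- `μ` is `D`-doubling up to scale `r₀`:
`0 < μ(B(x,2r)) ≤ D μ(B(x,r))` for all `x` and all `r ∈ (0,r₀)`. -/
def IsDoublingUpTo {X : Type*} [MetricSpace X] [MeasurableSpace X] (μ : Measure X)
    (D r₀ : ℝ) : Prop :=
  ∀ (x : X) (r : ℝ), 0 < r → r < r₀ →
    0 < μ (Metric.ball x (2 * r)) ∧
      μ (Metric.ball x (2 * r)) ≤ ENNReal.ofReal D * μ (Metric.ball x r)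

/-- The centered restricted maximal function `M_s g(x) = sup_{0 < r < s} ⨍_{B(x,r)} g dμ`. -/
def maximalFn {X : Type*} [MetricSpace X] [MeasurableSpace X] (μ : Measure X)
    (s : ℝ) (g : X → ℝ≥0∞) (x : X) : ℝ≥0∞ :=
  ⨆ r ∈ Ioo (0 : ℝ) s, ⨍⁻ z in Metric.ball x r, g z ∂μ

/-- The metric derivative `lim_{s → t} d(γ(s),γ(t)) / |s - t|` of a curve. The limit exists for
almost every `t` when `γ` is Lipschitz; the upper limit makes it defined for every `t`. -/
def metricSpeed {X : Type*} [MetricSpace X] (γ : ℝ → X) (t : ℝ) : ℝ≥0∞ :=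
  limsup (fun s => edist (γ s) (γ t) / edist s t) (𝓝[≠] t)

/-- The path integral `∫_γ g ds` along the Lipschitz curve `γ : [0,L] → X`. -/
def pathIntegral {X : Type*} [MetricSpace X] (γ : ℝ → X) (L : ℝ) (g : X → ℝ≥0∞) : ℝ≥0∞ :=
  ∫⁻ t in Icc (0 : ℝ) L, g (γ t) * metricSpeed γ t

/-- `(C,δ,τ,p)`-max connectedness at scale `r₀`, that is, `p`-maximal connectivity at scale `r₀`
and at the single level `τ`: any `x, y` with `r = d(x,y) ∈ (0,r₀)` and any Borel set `E` with
`M_{Cr} 1_E (x) < τ` and `M_{Cr} 1_E (y) < τ` admit a 1-Lipschitz curve `γ : [0,L] → X`, `L > 0`,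
from `x` to `y` with `Len(γ) ≤ C r` and `∫_γ 1_E ds ≤ δ τ^{1/p} r`. -/
def IsMaxConnectedAtLevel {X : Type*} [MetricSpace X] [MeasurableSpace X] (μ : Measure X)
    (C δ τ p r₀ : ℝ) : Prop :=
  ∀ x y : X, 0 < dist x y → dist x y < r₀ →
    ∀ E : Set X, MeasurableSet E →
      maximalFn μ (C * dist x y) (E.indicator fun _ => 1) x < ENNReal.ofReal τ →
      maximalFn μ (C * dist x y) (E.indicator fun _ => 1) y < ENNReal.ofReal τ →
      ∃ (L : ℝ) (γ : ℝ → X), 0 < L ∧ LipschitzOnWith 1 γ (Icc 0 L) ∧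
        γ 0 = x ∧ γ L = y ∧
        eVariationOn γ (Icc 0 L) ≤ ENNReal.ofReal (C * dist x y) ∧
        pathIntegral γ L (E.indicator fun _ => 1) ≤
          ENNReal.ofReal (δ * τ ^ (1 / p) * dist x y)

/-- The pointwise Lipschitz constant `Lip[f](x) = limsup_{y → x} |f(x) - f(y)| / d(x,y)`
(equal to `0` at isolated points). -/
def lipConst {X : Type*} [MetricSpace X] (f : X → ℝ) (x : X) : ℝ≥0∞ :=
  limsup (fun y => edist (f y) (f x) / edist y x) (𝓝[≠] x)

/-- The `(1,p)`-Poincaré inequality at scale `r₀` with constant `C` and dilation factor `Λ`: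
for all Lipschitz `f : X → ℝ` and all balls `B = B(x,r)` with `r ∈ (0,r₀)`,
`⨍_B |f - f_B| dμ ≤ C r (⨍_{ΛB} Lip[f]^p dμ)^{1/p}`. -/
def HasPoincareInequality {X : Type*} [MetricSpace X] [MeasurableSpace X] (μ : Measure X)
    (p C Λ r₀ : ℝ) : Prop :=
  ∀ f : X → ℝ, (∃ K : ℝ≥0, LipschitzWith K f) →
    ∀ (x : X) (r : ℝ), 0 < r → r < r₀ →
      ⨍⁻ y in Metric.ball x r, ‖f y - ⨍ z in Metric.ball x r, f z ∂μ‖ₑ ∂μ ≤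
        ENNReal.ofReal (C * r) *
          (⨍⁻ y in Metric.ball x (Λ * r), lipConst f y ^ p ∂μ) ^ (1 / p)

end MaxConn

end

/-! Fix a lower semicontinuous `w ≥ Lip[f]^p`. The core is a pointwise estimate: `|f(x) - f(y)| ≤ Φ
λ d(x,y)` whenever the maximal function of `w`, up to radius `2C₀d(x,y)`, is at most `λ^p` at `x`
and `y`.

It is obtained by self-improvement (`HasPairwiseBound.improve`). Assume it with some `Φ` at all
levels `λ ≥ ε`; put `r = d(x,y)` and `E = {M_{C₀r} w > A λ^p}`. The weak-type estimate gives
`M_{C₀r} 1_E ≤ D³/A < τ` at `x` and `y`, so max connectedness supplies a curve. Off `E`, `Lip[f] ≤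
A^{1/p} λ`, which contributes at most `C₀ A^{1/p} λ r`. Each gap of the curve inside `E` has
endpoints outside `E` at distance at most `r/2`, so the assumed bound applies to them at level
`A^{1/p} λ`; all gaps together contribute at most `Φ A^{1/p} λ · δ τ^{1/p} r ≤ Φ λ r / 2`. Thus `Φ`
improves to `C₀ A^{1/p} + Φ/2`. Iteration starts from the global Lipschitz constant of `f` and
converges to `2 C₀ A^{1/p}`, which has forgotten both `f` and `ε`.

Consequently `|f(x) - f(y)|` on a ball of radius `R` is controlled by `R (Mw(x)^{1/p} +
Mw(y)^{1/p})`. As `Mw` is in weak `L¹`, `(Mw)^{1/p}` is in weak `L^p`, and `p > 1` makes it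
integrable on the ball (`setLIntegral_le_of_weakType`). By Vitali–Carathéodory the integral of `w`
can be taken arbitrarily close to that of `Lip[f]^p`. -/

namespace MaxConn

/-! ### Calculus along Lipschitz curves. -/

section Curves

variable {X : Type*} [MetricSpace X]

lemma lipConst_le {f : X → ℝ} {K : ℝ≥0} (hf : LipschitzWith K f) (x : X) : lipConst f x ≤ K := by
  refine limsup_le_of_le (h := ?_)
  exact Eventually.of_forall fun y => ENNReal.div_le_of_le_mul (hf y x)

lemma metricSpeed_le_one {γ : ℝ → X} {L : ℝ} (hγ : LipschitzOnWith 1 γ (Icc 0 L)) {t : ℝ}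
    (ht : t ∈ Ioo 0 L) : metricSpeed γ t ≤ 1 := by
  refine limsup_le_of_le (h := ?_)
  filter_upwards [mem_nhdsWithin_of_mem_nhds (Icc_mem_nhds ht.1 ht.2)] with s hs
  exact ENNReal.div_le_of_le_mul (by simpa using hγ hs (Ioo_subset_Icc_self ht))

lemma edist_le_mul_of_div_lt {α β : Type*} [PseudoMetricSpace α] [MetricSpace β] {x y : α}
    {u v : β} {b : ℝ≥0∞} (h : edist x y / edist u v < b) (huv : u ≠ v) :
    edist x y ≤ b * edist u v := by
  exact (ENNReal.div_le_iff (edist_pos.2 huv).ne' (edist_ne_top u v)).1 h.le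

/-- Chain rule: the derivative of `f ∘ γ` is at most `Lip[f]` times the metric speed. -/
lemma enorm_deriv_comp_le {f : X → ℝ} {K : ℝ≥0} (hf : LipschitzWith K f) {γ : ℝ → X} {L : ℝ}
    (hγ : LipschitzOnWith 1 γ (Icc 0 L)) {t : ℝ} (ht : t ∈ Ioo 0 L) :
    ‖deriv (f ∘ γ) t‖ₑ ≤ lipConst f (γ t) * metricSpeed γ t := by
  have h1 : lipConst f (γ t) ≠ ⊤ := ((lipConst_le hf _).trans_lt ENNReal.coe_lt_top).ne
  have h2 : metricSpeed γ t ≠ ⊤ := ((metricSpeed_le_one hγ ht).trans_lt ENNReal.one_lt_top).ne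
  refine ENNReal.le_mul_of_forall_lt (Or.inr h2) (Or.inl h1) fun b hb c hc => ?_
  have hb0 : b ≠ 0 := (bot_le.trans_lt hb).ne'
  have hc0 : c ≠ 0 := (bot_le.trans_lt hc).ne'
  rcases eq_or_ne b ⊤ with rfl | hbt
  · simp [ENNReal.top_mul hc0]
  rcases eq_or_ne c ⊤ with rfl | hct
  · simp [ENNReal.mul_top hb0]
  lift b to ℝ≥0 using hbt
  lift c to ℝ≥0 using hct
  have hcont : ContinuousAt γ t := hγ.continuousOn.continuousAt (Icc_mem_nhds ht.1 ht.2)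
  have e1 : ∀ᶠ y in 𝓝[≠] (γ t), edist (f y) (f (γ t)) / edist y (γ t) < b :=
    eventually_lt_of_limsup_lt hb
  have e2 : ∀ᶠ s in 𝓝[≠] t, edist (γ s) (γ t) / edist s t < c :=
    eventually_lt_of_limsup_lt hc
  rw [eventually_nhdsWithin_iff] at e1 e2
  have key : ‖deriv (f ∘ γ) t‖ ≤ (b * c : ℝ≥0) := by
    refine norm_deriv_le_of_lip' (NNReal.coe_nonneg _) ?_
    filter_upwards [hcont.eventually e1, e2] with s h1 h2
    rcases eq_or_ne s t with rfl | hst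
    · simp
    have h2' := edist_le_mul_of_div_lt (h2 hst) hst
    have h1' : edist (f (γ s)) (f (γ t)) ≤ b * edist (γ s) (γ t) := by
      -- The limsup defining `lipConst` runs over punctured neighbourhoods, so a return of `γ` to `γ
      -- t` is treated apart; there the increment of `f` vanishes.
      rcases eq_or_ne (γ s) (γ t) with he | hne
      · simp [he]
      · exact edist_le_mul_of_div_lt (h1 hne) hne
    have : edist (f (γ s)) (f (γ t)) ≤ (b * c : ℝ≥0) * edist s t := by
      calc _ ≤ _ := h1'
        _ ≤ b * (c * edist s t) := by gcongr
        _ = _ := by push_cast; ring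
    rw [edist_nndist, edist_nndist, ← ENNReal.coe_mul, ENNReal.coe_le_coe] at this
    have := NNReal.coe_le_coe.2 this
    rw [NNReal.coe_mul, coe_nndist, coe_nndist, Real.dist_eq, Real.dist_eq] at this
    simpa using this
  rw [← ENNReal.coe_mul, enorm_eq_nnnorm, ENNReal.coe_le_coe]
  exact_mod_cast key

lemma integral_Ioo_deriv {h : ℝ → ℝ} {K : ℝ≥0} {L : ℝ} (hh : LipschitzOnWith K h (Icc 0 L))
    {a b : ℝ} (ha : 0 ≤ a) (hab : a ≤ b) (hb : b ≤ L) :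
    IntegrableOn (deriv h) (Ioo a b) ∧ ∫ t in Ioo a b, deriv h t = h b - h a := by
  have hac : AbsolutelyContinuousOnInterval h a b := by
    refine (hh.mono ?_).absolutelyContinuousOnInterval
    rw [uIcc_of_le hab]
    exact Icc_subset_Icc ha hb
  refine ⟨(hac.intervalIntegrable_deriv.1).mono_set Ioo_subset_Ioc_self, ?_⟩
  rw [← integral_Ioc_eq_integral_Ioo, ← intervalIntegral.integral_of_le hab]
  exact hac.integral_deriv_eq_sub

lemma lipConst_dist_le_one (z x : X) : lipConst (fun y => dist z y) x ≤ 1 := by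
  simpa using lipConst_le (LipschitzWith.dist_right z) x

/-- Apply the chain rule to the 1-Lipschitz function `dist (γ a) ·`, whose increment along the curve
is the distance of the endpoints. -/
lemma edist_le_lintegral_metricSpeed {γ : ℝ → X} {L : ℝ} (hγ : LipschitzOnWith 1 γ (Icc 0 L))
    {a b : ℝ} (ha : 0 ≤ a) (hab : a ≤ b) (hb : b ≤ L) :
    edist (γ a) (γ b) ≤ ∫⁻ t in Ioo a b, metricSpeed γ t := by
  set f : X → ℝ := fun y => dist (γ a) y
  have hf : LipschitzWith 1 f := LipschitzWith.dist_right _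
  have hfγ : LipschitzOnWith (1 * 1) (f ∘ γ) (Icc 0 L) :=
    hf.comp_lipschitzOnWith hγ
  have h := (integral_Ioo_deriv hfγ ha hab hb).2
  have e : edist (γ a) (γ b) = ‖∫ t in Ioo a b, deriv (f ∘ γ) t‖ₑ := by
    rw [h, edist_dist]
    simp only [f, Function.comp, dist_self, sub_zero]
    rw [Real.enorm_of_nonneg dist_nonneg]
  rw [e]
  refine (enorm_integral_le_lintegral_enorm _).trans (setLIntegral_mono' measurableSet_Ioo ?_)
  intro t ht
  refine (enorm_deriv_comp_le hf hγ ⟨ha.trans_lt ht.1, ht.2.trans_le hb⟩).trans ?_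
  exact (mul_le_mul_left (lipConst_dist_le_one _ _) _).trans (one_mul _).le

/-- The integral of the metric speed is at most the length of the curve. -/
lemma lintegral_metricSpeed_le {γ : ℝ → X} {L : ℝ} (hL : 0 < L)
    (hγ : LipschitzOnWith 1 γ (Icc 0 L)) :
    ∫⁻ t in Ioo 0 L, metricSpeed γ t ≤ eVariationOn γ (Icc 0 L) := by
  set s := Icc (0 : ℝ) L
  have h0 : (0 : ℝ) ∈ s := ⟨le_rfl, hL.le⟩
  have hbv : LocallyBoundedVariationOn γ s := by
    have := hγ.comp_locallyBoundedVariationOn (g := id) (s := s) (mapsTo_id _)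
      (monotoneOn_id.locallyBoundedVariationOn)
    simpa using this
  -- `V` is arc length. It is monotone and 1-Lipschitz, its increments dominate distances along `γ`,
  -- so its derivative dominates the metric speed almost everywhere, and that derivative integrates
  -- to the length.
  set V := variationOnFromTo γ s 0
  have hmono : MonotoneOn V s := variationOnFromTo.monotoneOn hbv h0
  have hsub : ∀ a ∈ s, ∀ b ∈ s, a ≤ b → ENNReal.ofReal (V b - V a) = eVariationOn γ (s ∩ Icc a b) := by
    intro a ha b hb hab
    have : V b - V a = variationOnFromTo γ s a b := by
      have := variationOnFromTo.add hbv h0 ha hb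
      simp only [V]; linarith
    rw [this, variationOnFromTo.eq_of_le _ _ hab, ENNReal.ofReal_toReal (hbv a b ha hb)]
  have hlip : LipschitzOnWith 1 V s := by
    refine LipschitzOnWith.of_le_add ?_
    intro a ha b hb
    rcases le_total a b with hab | hab
    · exact (hmono ha hb hab).trans (le_add_of_nonneg_right dist_nonneg)
    · have h1 := hsub b hb a ha hab
      have h2 : eVariationOn γ (s ∩ Icc b a) ≤ ENNReal.ofReal (a - b) := by
        have := (hγ.mono inter_subset_left).comp_eVariationOn_le (g := id) (s := s ∩ Icc b a)
          (mapsTo_id _)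
        refine this.trans ?_
        rw [monotoneOn_id.eVariationOn_eq hb ha]
        simp
      rw [← h1] at h2
      have := (ENNReal.ofReal_le_ofReal_iff (sub_nonneg.2 hab)).1 h2
      rw [Real.dist_eq, abs_of_nonneg (sub_nonneg.2 hab)]
      linarith
  obtain ⟨hint, heq⟩ := integral_Ioo_deriv hlip le_rfl hL.le le_rfl
  have hdiff : ∀ᵐ t, t ∈ s → DifferentiableWithinAt ℝ V s t :=
    hlip.ae_differentiableWithinAt_of_mem_real
  have hdiff' : ∀ᵐ t ∂(volume.restrict (Ioo 0 L)), t ∈ Ioo 0 L ∧ DifferentiableAt ℝ V t := by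
    filter_upwards [ae_restrict_of_ae hdiff, ae_restrict_mem measurableSet_Ioo] with t h ht
    exact ⟨ht, (h (Ioo_subset_Icc_self ht)).differentiableAt (Icc_mem_nhds ht.1 ht.2)⟩
  have hnn : ∀ t ∈ Ioo 0 L, 0 ≤ deriv V t := by
    intro t ht
    rw [← derivWithin_of_mem_nhds (Icc_mem_nhds ht.1 ht.2)]
    exact hmono.derivWithin_nonneg
  calc ∫⁻ t in Ioo 0 L, metricSpeed γ t ≤ ∫⁻ t in Ioo 0 L, ENNReal.ofReal (deriv V t) := by
        refine lintegral_mono_ae ?_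
        filter_upwards [hdiff'] with t ⟨ht, hd⟩
        have h1 := hasDerivAt_iff_tendsto_slope.1 hd.hasDerivAt
        have h2 : Tendsto (fun u => ENNReal.ofReal (slope V t u)) (𝓝[≠] t)
          (𝓝 (ENNReal.ofReal (deriv V t))) := ENNReal.tendsto_ofReal h1
        rw [← h2.limsup_eq]
        refine limsup_le_limsup ?_
        filter_upwards [mem_nhdsWithin_of_mem_nhds (Icc_mem_nhds ht.1 ht.2),
          self_mem_nhdsWithin] with u hu hne
        have ht' := Ioo_subset_Icc_self ht
        have hut : (0 : ℝ) < |u - t| := abs_pos.2 (sub_ne_zero.2 hne)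
        have hs : slope V t u = |V u - V t| / |u - t| := by
          rw [slope_def_field, ← abs_div]
          refine (abs_of_nonneg ?_).symm
          rcases le_total u t with h | h
          · exact div_nonneg_of_nonpos (sub_nonpos.2 (hmono hu ht' h)) (sub_nonpos.2 h)
          · exact div_nonneg (sub_nonneg.2 (hmono ht' hu h)) (sub_nonneg.2 h)
        rw [hs, ENNReal.ofReal_div_of_pos hut, edist_dist u t, Real.dist_eq]
        gcongr
        rcases le_total u t with h | h
        · rw [abs_sub_comm, abs_of_nonneg (sub_nonneg.2 (hmono hu ht' h)), hsub u hu t ht' h]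
          exact eVariationOn.edist_le _ ⟨hu, le_rfl, h⟩ ⟨ht', h, le_rfl⟩
        · rw [abs_of_nonneg (sub_nonneg.2 (hmono ht' hu h)), hsub t ht' u hu h]
          exact eVariationOn.edist_le _ ⟨hu, h, le_rfl⟩ ⟨ht', le_rfl, h⟩
    _ = ENNReal.ofReal (∫ t in Ioo 0 L, deriv V t) := by
        rw [ofReal_integral_eq_lintegral_ofReal hint]
        filter_upwards [ae_restrict_mem measurableSet_Ioo] with t ht using hnn t ht
    _ = eVariationOn γ (Icc 0 L) := by
        rw [heq, hsub 0 h0 L ⟨hL.le, le_rfl⟩ hL.le, inter_self]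

end Curves

/-- An integral over a bounded open subset of the line can be estimated component by component. -/
lemma enorm_setIntegral_le_of_components {O : Set ℝ} (hO : IsOpen O) {c d : ℝ}
    (hcd : O ⊆ Ioo c d) {φ : ℝ → ℝ} (hφ : IntegrableOn φ O) {ψ : ℝ → ℝ≥0∞}
    (h : ∀ a b, c ≤ a → a < b → b ≤ d → Ioo a b ⊆ O → a ∉ O → b ∉ O →
      ‖∫ t in Ioo a b, φ t‖ₑ ≤ ∫⁻ t in Ioo a b, ψ t) :
    ‖∫ t in O, φ t‖ₑ ≤ ∫⁻ t in O, ψ t := by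
  set T : Set (ℝ × ℝ) := {q | c ≤ q.1 ∧ q.1 < q.2 ∧ q.2 ≤ d ∧ Ioo q.1 q.2 ⊆ O ∧ q.1 ∉ O ∧ q.2 ∉ O}
  have hdisj : T.PairwiseDisjoint (fun q => Ioo q.1 q.2) := by
    rintro ⟨a, b⟩ ⟨-, hab, -, hs, ha, hb⟩ ⟨a', b'⟩ ⟨-, hab', -, hs', ha', hb'⟩ hne
    refine Set.disjoint_left.2 fun t ht ht' => hne ?_
    simp only [mem_Ioo] at ht ht'
    have h1 : ¬ a < a' := fun hlt => ha' (hs ⟨hlt, ht'.1.trans ht.2⟩)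
    have h2 : ¬ a' < a := fun hlt => ha (hs' ⟨hlt, ht.1.trans ht'.2⟩)
    have h3 : ¬ b < b' := fun hlt => hb (hs' ⟨ht'.1.trans ht.2, hlt⟩)
    have h4 : ¬ b' < b := fun hlt => hb' (hs ⟨ht.1.trans ht'.2, hlt⟩)
    exact Prod.ext (le_antisymm (not_lt.1 h2) (not_lt.1 h1))
      (le_antisymm (not_lt.1 h4) (not_lt.1 h3))
  have hcount : T.Countable :=
    hdisj.countable_of_isOpen (fun _ _ => isOpen_Ioo) (fun q hq => nonempty_Ioo.2 hq.2.1)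
  have hun : O = ⋃ q : T, Ioo q.1.1 q.1.2 := by
    refine Subset.antisymm (fun t ht => ?_) (iUnion_subset fun q => q.2.2.2.2.1)
    have htcd := hcd ht
    have hcO : c ∉ O := fun h => (hcd h).1.false
    have hdO : d ∉ O := fun h => (hcd h).2.false
    have hA : IsClosed (Oᶜ ∩ Icc c t) := hO.isClosed_compl.inter isClosed_Icc
    have hB : IsClosed (Oᶜ ∩ Icc t d) := hO.isClosed_compl.inter isClosed_Icc
    have hAb : BddAbove (Oᶜ ∩ Icc c t) := bddAbove_Icc.mono inter_subset_right
    have hBb : BddBelow (Oᶜ ∩ Icc t d) := bddBelow_Icc.mono inter_subset_right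
    have ha := hA.csSup_mem ⟨c, hcO, le_rfl, htcd.1.le⟩ hAb
    have hb := hB.csInf_mem ⟨d, hdO, htcd.2.le, le_rfl⟩ hBb
    -- The component of `O` containing `t` runs from the last point of the complement before `t` to
    -- the first one after it.
    set a := sSup (Oᶜ ∩ Icc c t)
    set b := sInf (Oᶜ ∩ Icc t d)
    have hat : a < t := lt_of_le_of_ne ha.2.2 fun h => ha.1 (h ▸ ht)
    have htb : t < b := lt_of_le_of_ne hb.2.1 fun h => hb.1 (h ▸ ht)
    refine mem_iUnion.2 ⟨⟨(a, b), ha.2.1, hat.trans htb, hb.2.2, fun u hu => ?_, ha.1, hb.1⟩,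
      hat, htb⟩
    by_contra huO
    rcases le_total u t with hut | hut
    · exact (le_csSup hAb ⟨huO, ha.2.1.trans hu.1.le, hut⟩).not_gt hu.1
    · exact (csInf_le hBb ⟨huO, hut, hu.2.le.trans hb.2.2⟩).not_gt hu.2
  have := hcount.to_subtype
  have hm : ∀ q : T, MeasurableSet (Ioo q.1.1 q.1.2) := fun _ => measurableSet_Ioo
  have hd' : Pairwise (Function.onFun Disjoint fun q : T => Ioo q.1.1 q.1.2) :=
    hdisj.subtype _ _
  rw [hun, integral_iUnion hm hd' (hun ▸ hφ), lintegral_iUnion hm hd']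
  refine enorm_tsum_le_tsum_enorm.trans (ENNReal.tsum_le_tsum fun q => ?_)
  obtain ⟨h1, h2, h3, h4, h5, h6⟩ := q.2
  exact h _ _ h1 h2 h3 h4 h5 h6

/-! ### Oscillation along a curve that crosses an open set. -/

section Curves

variable {X : Type*} [MetricSpace X]

/-- Dropping the two endpoints, a null set, makes the set of times spent in `E` open in `ℝ`, hence a
union of intervals. -/
lemma pathIntegral_indicator_eq {γ : ℝ → X} {L : ℝ} (hγ : ContinuousOn γ (Icc 0 L)) {E : Set X}
    (hE : IsOpen E) :
    IsOpen (Ioo 0 L ∩ γ ⁻¹' E) ∧ pathIntegral γ L (E.indicator fun _ => 1) =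
      ∫⁻ t in Ioo 0 L ∩ γ ⁻¹' E, metricSpeed γ t := by
  have hO : IsOpen (Ioo 0 L ∩ γ ⁻¹' E) :=
    (hγ.mono Ioo_subset_Icc_self).isOpen_inter_preimage isOpen_Ioo hE
  refine ⟨hO, ?_⟩
  have h := setLIntegral_indicator (μ := volume) hO.measurableSet (t := Ioo 0 L) (metricSpeed γ)
  rw [inter_eq_self_of_subset_left inter_subset_left] at h
  rw [pathIntegral, setLIntegral_congr Ioo_ae_eq_Icc.symm, ← h]
  refine setLIntegral_congr_fun measurableSet_Ioo fun t ht => ?_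
  by_cases h : γ t ∈ E
  · simp [indicator, h, ht.1, ht.2]
  · simp [indicator, h]

/-- Oscillation of a Lipschitz function along a curve, in terms of a bound for its upper gradient
off an open set `E` and of a Lipschitz bound across the gaps of the curve in `E`. -/
lemma edist_comp_endpoints_le {f : X → ℝ} {K : ℝ≥0} (hf : LipschitzWith K f) {γ : ℝ → X} {L : ℝ}
    (hL : 0 < L) (hγ : LipschitzOnWith 1 γ (Icc 0 L)) {E : Set X} (hE : IsOpen E)
    (h0 : γ 0 ∉ E) (hL' : γ L ∉ E) {G H : ℝ≥0∞} (hG : G ≠ ⊤) (hH : H ≠ ⊤)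
    (hGE : ∀ z ∉ E, lipConst f z ≤ G)
    (hHE : ∀ u ∉ E, ∀ v ∉ E, edist u v ≤ pathIntegral γ L (E.indicator fun _ => 1) →
      edist (f u) (f v) ≤ H * edist u v) :
    edist (f (γ 0)) (f (γ L)) ≤
      G * eVariationOn γ (Icc 0 L) + H * pathIntegral γ L (E.indicator fun _ => 1) := by
  obtain ⟨hO, hpath⟩ := pathIntegral_indicator_eq hγ.continuousOn hE
  have hfγ : LipschitzOnWith (K * 1) (f ∘ γ) (Icc 0 L) := hf.comp_lipschitzOnWith hγ
  obtain ⟨hint, heq⟩ := integral_Ioo_deriv hfγ le_rfl hL.le le_rfl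
  set O := Ioo 0 L ∩ γ ⁻¹' E
  have hsub : O ⊆ Ioo 0 L := inter_subset_left
  have e : edist (f (γ 0)) (f (γ L)) = ‖∫ t in Ioo 0 L, deriv (f ∘ γ) t‖ₑ := by
    rw [heq, edist_comm, edist_eq_enorm_sub]; rfl
  have hsplit : ∫ t in Ioo 0 L, deriv (f ∘ γ) t =
      (∫ t in Ioo 0 L \ O, deriv (f ∘ γ) t) + ∫ t in O, deriv (f ∘ γ) t := by
    rw [← setIntegral_union disjoint_sdiff_left hO.measurableSet (hint.mono_set sdiff_subset)
      (hint.mono_set hsub), sdiff_union_of_subset hsub]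
  rw [e, hsplit]
  refine (enorm_add_le _ _).trans (add_le_add ?_ ?_)
  · calc ‖∫ t in Ioo 0 L \ O, deriv (f ∘ γ) t‖ₑ
        ≤ ∫⁻ t in Ioo 0 L \ O, ‖deriv (f ∘ γ) t‖ₑ := enorm_integral_le_lintegral_enorm _
      _ ≤ ∫⁻ t in Ioo 0 L \ O, G * metricSpeed γ t := by
          refine setLIntegral_mono' (measurableSet_Ioo.diff hO.measurableSet) fun t ht => ?_
          have : γ t ∉ E := fun h => ht.2 ⟨ht.1, h⟩
          exact (enorm_deriv_comp_le hf hγ ht.1).trans (mul_le_mul_left (hGE _ this) _)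
      _ = G * ∫⁻ t in Ioo 0 L \ O, metricSpeed γ t := lintegral_const_mul' _ _ hG
      _ ≤ G * ∫⁻ t in Ioo 0 L, metricSpeed γ t := by
          gcongr; exact sdiff_subset
      _ ≤ _ := by gcongr; exact lintegral_metricSpeed_le hL hγ
  · rw [hpath, ← lintegral_const_mul' _ _ hH]
    -- Endpoints of a component of `O` are sent outside `E`, and their distance is at most the
    -- integral of the speed over the component, hence at most the whole path integral of `1_E`. So
    -- `hHE` applies to them.
    refine enorm_setIntegral_le_of_components hO hsub (hint.mono_set hsub) ?_
    intro a b ha hab hb habO haO hbO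
    have haE : γ a ∉ E := by
      rcases ha.eq_or_lt with rfl | ha'
      · exact h0
      · exact fun h => haO ⟨⟨ha', hab.trans_le hb⟩, h⟩
    have hbE : γ b ∉ E := by
      rcases hb.eq_or_lt with rfl | hb'
      · exact hL'
      · exact fun h => hbO ⟨⟨ha.trans_lt hab, hb'⟩, h⟩
    have hd := edist_le_lintegral_metricSpeed hγ ha hab.le hb
    rw [(integral_Ioo_deriv hfγ ha hab.le hb).2, lintegral_const_mul' _ _ hH]
    have : ‖(f ∘ γ) b - (f ∘ γ) a‖ₑ = edist (f (γ a)) (f (γ b)) := by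
      rw [edist_comm, edist_eq_enorm_sub]; rfl
    rw [this]
    refine (hHE _ haE _ hbE ?_).trans (by gcongr)
    rw [hpath]
    exact hd.trans (lintegral_mono_set habO)

end Curves

/-! ### Measurability of the pointwise Lipschitz constant. -/

section LipConst

variable {X : Type*} [MetricSpace X]

/-- For fixed `y` the quotient is continuous in `x`, and the constraint on `x` is open, so a nearly
optimal `y` remains admissible for nearby centers. -/
lemma lowerSemicontinuous_iSup_slope {f : X → ℝ} (hf : Continuous f) (r : ℝ) :
    LowerSemicontinuous fun x =>
      ⨆ y ∈ Metric.ball x r ∩ {x}ᶜ, edist (f y) (f x) / edist y x := by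
  intro x b hb
  obtain ⟨y, hy⟩ := lt_iSup_iff.1 hb
  obtain ⟨hyx, hy⟩ := lt_iSup_iff.1 hy
  have hne : y ≠ x := hyx.2
  have hc : ContinuousAt (fun z => edist (f y) (f z) / edist y z) x := by
    refine ENNReal.Tendsto.div ?_ (Or.inr (edist_pos.2 hne).ne') ?_ (Or.inl (edist_ne_top _ _))
    · exact (continuous_const.edist hf).continuousAt
    · exact (continuous_const.edist continuous_id).continuousAt
  have h1 : ∀ᶠ z in 𝓝 x, dist y z < r :=
    (continuous_const.dist continuous_id).continuousAt.eventually_lt_const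
      (by simpa [id] using hyx.1)
  have h2 : ∀ᶠ z in 𝓝 x, y ≠ z := by
    filter_upwards [isOpen_ne.mem_nhds hne.symm] with z hz using fun h => hz h.symm
  filter_upwards [hc.eventually_const_lt hy, h1, h2] with z hz h1 h2
  exact hz.trans_le (le_iSup₂ (f := fun y _ => edist (f y) (f z) / edist y z) y ⟨h1, h2⟩)

lemma measurable_lipConst [MeasurableSpace X] [BorelSpace X] {f : X → ℝ} (hf : Continuous f) :
    Measurable (lipConst f) := by
  have : lipConst f = fun x => ⨅ n : ℕ,
      ⨆ y ∈ Metric.ball x (1 / ((n : ℝ) + 1)) ∩ {x}ᶜ, edist (f y) (f x) / edist y x := by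
    ext x
    have := (nhdsWithin_hasBasis (Metric.nhds_basis_ball_inv_nat_succ (x := x)) {x}ᶜ).limsup_eq_iInf_iSup
      (u := fun y => edist (f y) (f x) / edist y x)
    simpa [lipConst] using this
  rw [this]
  exact Measurable.iInf fun n => (lowerSemicontinuous_iSup_slope hf _).measurable

end LipConst

/-! ### Doubling and the restricted maximal function. -/

section Maximal

variable {X : Type*} [MetricSpace X] [MeasurableSpace X] {μ : Measure X}

lemma IsDoublingUpTo.measure_ball_pos {D r₀ : ℝ} (h : IsDoublingUpTo μ D r₀) (hr₀ : 0 < r₀)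
    (x : X) {r : ℝ} (hr : 0 < r) : 0 < μ (Metric.ball x r) := by
  have hm : 0 < min r r₀ := lt_min hr hr₀
  refine (h x (min r r₀ / 2) (by linarith) (by linarith [min_le_right r r₀])).1.trans_le
    (measure_mono (Metric.ball_subset_ball ?_))
  linarith [min_le_left r r₀]

lemma IsDoublingUpTo.measure_ball_le_pow {D r₀ : ℝ} (h : IsDoublingUpTo μ D r₀) (x : X) {r : ℝ}
    (hr : 0 < r) (hr₀ : r ≤ r₀) (k : ℕ) :
    μ (Metric.ball x r) ≤ ENNReal.ofReal D ^ k * μ (Metric.ball x (r / 2 ^ k)) := by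
  induction k with
  | zero => simp
  | succ k ih =>
    refine ih.trans ?_
    have h3 : r / 2 ^ k = 2 * (r / 2 ^ (k + 1)) := by rw [pow_succ]; field_simp
    have h2 : (0 : ℝ) < 2 ^ (k + 1) := by positivity
    have h1 := (h x (r / 2 ^ (k + 1)) (by positivity) ?_).2
    · rw [pow_succ, mul_assoc, h3]
      gcongr
    · rw [div_lt_iff₀ h2]
      have : (2 : ℝ) ≤ 2 ^ (k + 1) := by
        rw [pow_succ]; linarith [one_le_pow₀ (M₀ := ℝ) (a := 2) (n := k) (by norm_num)]
      nlinarith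

lemma IsDoublingUpTo.measure_ball_four_le {D r₀ : ℝ} (h : IsDoublingUpTo μ D r₀) (x : X) {r : ℝ}
    (hr : 0 < r) (hr₀ : 2 * r < r₀) :
    μ (Metric.ball x (4 * r)) ≤ ENNReal.ofReal D ^ 2 * μ (Metric.ball x r) := by
  have h1 := (h x (2 * r) (by linarith) hr₀).2
  have h2 := (h x r hr (by linarith)).2
  rw [show 4 * r = 2 * (2 * r) by ring, pow_two, mul_assoc]
  exact h1.trans (by gcongr)

lemma measure_ball_ne_top [ProperSpace X] [IsFiniteMeasureOnCompacts μ] (x : X) (r : ℝ) :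
    μ (Metric.ball x r) ≠ ⊤ := measure_ball_lt_top.ne

lemma maximalFn_mono_radius {s t : ℝ} (h : s ≤ t) (g : X → ℝ≥0∞) (x : X) :
    maximalFn μ s g x ≤ maximalFn μ t g x :=
  biSup_mono fun _ hr => ⟨hr.1, hr.2.trans_le h⟩

lemma exists_of_lt_maximalFn {s : ℝ} {g : X → ℝ≥0∞} {x : X} {a : ℝ≥0∞}
    (h : a < maximalFn μ s g x) :
    ∃ t, 0 < t ∧ t < s ∧ a * μ (Metric.ball x t) < ∫⁻ z in Metric.ball x t, g z ∂μ := by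
  obtain ⟨t, ht⟩ := lt_iSup_iff.1 h
  obtain ⟨ht', ht⟩ := lt_iSup_iff.1 ht
  rw [setLAverage_eq] at ht
  exact ⟨t, ht'.1, ht'.2, ENNReal.mul_lt_of_lt_div ht⟩

/-- Weak-type estimate from the Vitali covering lemma. -/
lemma IsDoublingUpTo.mul_measure_le_of_forall_exists_ball [ProperSpace X] [BorelSpace X]
    {D r₀ : ℝ} (h : IsDoublingUpTo μ D r₀)
    {S U : Set X} {g : X → ℝ≥0∞} {a : ℝ≥0∞} {T : ℝ} (hT : 2 * T ≤ r₀)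
    (hS : ∀ z ∈ S, ∃ t, 0 < t ∧ t < T ∧ Metric.ball z t ⊆ U ∧
      a * μ (Metric.ball z t) ≤ ∫⁻ y in Metric.ball z t, g y ∂μ) :
    a * μ S ≤ ENNReal.ofReal D ^ 2 * ∫⁻ y in U, g y ∂μ := by
  choose! t ht0 htT htU hta using hS
  -- The covering lemma needs a factor above 3; with `7/2` the enlarged closed balls fit in open
  -- balls of radius `4t`, which cost exactly two doublings.
  obtain ⟨u, huS, hdisj, hcov⟩ := Vitali.exists_disjoint_subfamily_covering_enlargement_closedBall
    S id t T (fun z hz => (htT z hz).le) (7 / 2) (by norm_num)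
  have hdisj' : u.PairwiseDisjoint fun z => Metric.ball z (t z) :=
    hdisj.mono fun z => Metric.ball_subset_closedBall
  have hcount : u.Countable := hdisj'.countable_of_isOpen (fun _ _ => Metric.isOpen_ball)
    fun z hz => Metric.nonempty_ball.2 (ht0 z (huS hz))
  have hsub : S ⊆ ⋃ z ∈ u, Metric.ball z (4 * t z) := by
    intro z hz
    obtain ⟨b, hb, hzb⟩ := hcov z hz
    have := ht0 b (huS hb)
    refine mem_iUnion₂.2 ⟨b, hb, Metric.closedBall_subset_ball (by linarith)
      (hzb (Metric.mem_closedBall_self (ht0 z hz).le))⟩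
  calc a * μ S ≤ a * ∑' z : u, μ (Metric.ball z.1 (4 * t z)) := by
        gcongr
        exact (measure_mono hsub).trans (measure_biUnion_le μ hcount _)
    _ ≤ a * ∑' z : u, ENNReal.ofReal D ^ 2 * μ (Metric.ball z.1 (t z)) := by
        gcongr with z
        have h1 := ht0 z (huS z.2)
        have h2 := htT z (huS z.2)
        exact h.measure_ball_four_le z.1 h1 (by linarith)
    _ = ENNReal.ofReal D ^ 2 * ∑' z : u, a * μ (Metric.ball z.1 (t z)) := by
        rw [ENNReal.tsum_mul_left, ENNReal.tsum_mul_left]; ring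
    _ ≤ ENNReal.ofReal D ^ 2 * ∑' z : u, ∫⁻ y in Metric.ball z.1 (t z), g y ∂μ := by
        gcongr with z
        exact hta z (huS z.2)
    _ = ENNReal.ofReal D ^ 2 * ∫⁻ y in ⋃ z ∈ u, Metric.ball z (t z), g y ∂μ := by
        rw [lintegral_biUnion hcount (fun _ _ => measurableSet_ball) hdisj']
    _ ≤ _ := by
        gcongr
        exact iUnion₂_subset fun z hz => htU z (huS hz)

variable [ProperSpace X] [IsFiniteMeasureOnCompacts μ]

lemma setLIntegral_ball_le_of_maximalFn_le (hpos : ∀ (x : X) (r : ℝ), 0 < r → 0 < μ (Metric.ball x r))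
    {s : ℝ} {g : X → ℝ≥0∞} {x : X} {c : ℝ≥0∞} (h : maximalFn μ s g x ≤ c) {t : ℝ} (ht : 0 < t)
    (hts : t < s) : ∫⁻ z in Metric.ball x t, g z ∂μ ≤ c * μ (Metric.ball x t) := by
  have : ⨍⁻ z in Metric.ball x t, g z ∂μ ≤ c :=
    (le_iSup₂ (f := fun r _ => ⨍⁻ z in Metric.ball x r, g z ∂μ) t ⟨ht, hts⟩).trans h
  rwa [setLAverage_eq, ENNReal.div_le_iff (hpos x t ht).ne' (measure_ball_ne_top x t)] at this

lemma lt_maximalFn_of_lt_setLIntegral (hpos : ∀ (x : X) (r : ℝ), 0 < r → 0 < μ (Metric.ball x r))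
    {s : ℝ} {g : X → ℝ≥0∞} {x : X} {a : ℝ≥0∞} {t : ℝ} (ht : 0 < t) (hts : t < s)
    (h : a * μ (Metric.ball x t) < ∫⁻ z in Metric.ball x t, g z ∂μ) :
    a < maximalFn μ s g x := by
  by_contra! hle
  exact (setLIntegral_ball_le_of_maximalFn_le hpos hle ht hts).not_gt h

variable [BorelSpace X]

/-- A strict inequality on `B(x,r)` survives in the numerator on a smaller ball `B(x,r-2η)`. For `y`
within `η` of `x`, `B(y,r-η)` lies between the two balls and inherits it. -/
lemma lowerSemicontinuous_maximalFn
    (hpos : ∀ (x : X) (r : ℝ), 0 < r → 0 < μ (Metric.ball x r)) (s : ℝ) (g : X → ℝ≥0∞) :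
    LowerSemicontinuous (maximalFn μ s g) := by
  intro x a ha
  obtain ⟨r, hr, hrs, hlt⟩ := exists_of_lt_maximalFn ha
  have hun : Metric.ball x r = ⋃ n : ℕ, Metric.ball x (r - 1 / ((n : ℝ) + 1)) := by
    refine Subset.antisymm (fun y hy => ?_) (iUnion_subset fun n => Metric.ball_subset_ball ?_)
    · obtain ⟨n, hn⟩ := exists_nat_one_div_lt (sub_pos.2 (Metric.mem_ball.1 hy))
      exact mem_iUnion.2 ⟨n, Metric.mem_ball.2 (by linarith)⟩
    · have : (0 : ℝ) < 1 / ((n : ℝ) + 1) := by positivity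
      linarith
  have hmono : Monotone fun n : ℕ => Metric.ball x (r - 1 / ((n : ℝ) + 1)) := fun m n hmn =>
    Metric.ball_subset_ball (sub_le_sub_left (Nat.one_div_le_one_div hmn) _)
  rw [← withDensity_apply g measurableSet_ball] at hlt
  nth_rewrite 2 [hun] at hlt
  rw [hmono.measure_iUnion, lt_iSup_iff] at hlt
  obtain ⟨n, hn⟩ := hlt
  set η : ℝ := 1 / ((n : ℝ) + 1) / 2 with hη
  have hη0 : 0 < η := by positivity
  have hr' : r - 1 / ((n : ℝ) + 1) = r - 2 * η := by rw [hη]; ring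
  rw [hr'] at hn
  have hrη : 0 < r - 2 * η := by
    by_contra! hle
    rw [Metric.ball_eq_empty.2 hle] at hn
    simp at hn
  filter_upwards [Metric.ball_mem_nhds x hη0] with y hy
  rw [Metric.mem_ball] at hy
  refine lt_maximalFn_of_lt_setLIntegral hpos (t := r - η) (by linarith) (by linarith) ?_
  rw [← withDensity_apply g measurableSet_ball]
  calc a * μ (Metric.ball y (r - η)) ≤ a * μ (Metric.ball x r) := by
        gcongr; exact Metric.ball_subset_ball' (by linarith)
    _ < _ := hn
    _ ≤ _ := by
        refine measure_mono (Metric.ball_subset_ball' ?_)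
        rw [dist_comm]; linarith

/-- Lower semicontinuity gives this at every point. Lebesgue differentiation would give it only
almost everywhere, which is useless along a curve of measure zero. -/
lemma le_maximalFn_of_lowerSemicontinuous
    (hpos : ∀ (x : X) (r : ℝ), 0 < r → 0 < μ (Metric.ball x r)) {s : ℝ} (hs : 0 < s)
    {g : X → ℝ≥0∞} (hg : LowerSemicontinuous g) (x : X) : g x ≤ maximalFn μ s g x := by
  refine le_of_forall_lt fun a ha => ?_
  obtain ⟨b, hab, hb⟩ := exists_between ha
  obtain ⟨ε, hε, hball⟩ := Metric.eventually_nhds_iff_ball.1 (hg x b hb)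
  have ht : 0 < min ε (s / 2) := lt_min hε (by linarith)
  refine lt_maximalFn_of_lt_setLIntegral hpos ht (by linarith [min_le_right ε (s / 2)]) ?_
  calc a * μ (Metric.ball x (min ε (s / 2))) < b * μ (Metric.ball x (min ε (s / 2))) :=
        (ENNReal.mul_lt_mul_iff_left (hpos x _ ht).ne' (measure_ball_ne_top _ _)).2 hab
    _ = ∫⁻ _ in Metric.ball x (min ε (s / 2)), b ∂μ := (setLIntegral_const _ _).symm
    _ ≤ _ := setLIntegral_mono' measurableSet_ball fun z hz =>
        (hball z (Metric.ball_subset_ball (min_le_left _ _) hz)).le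

end Maximal

/-! ### From weak type to integrability. -/

section WeakType

/-- The terms double, so `U` plus the first `n` of them is `U * 2 ^ n` as long as all thresholds lie
below `x`. -/
lemma le_add_tsum_dyadic (x : ℝ≥0∞) {U : ℝ≥0∞} (hU : U ≠ 0) :
    x ≤ U + ∑' k : ℕ, if U * 2 ^ k < x then U * 2 ^ k else 0 := by
  set S := U + ∑' k : ℕ, if U * 2 ^ k < x then U * 2 ^ k else 0
  have key : ∀ n : ℕ, min x (U * 2 ^ n) ≤
      U + ∑ k ∈ Finset.range n, if U * 2 ^ k < x then U * 2 ^ k else 0 := by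
    intro n
    induction n with
    | zero => simp
    | succ n ih =>
      rw [Finset.sum_range_succ, ← add_assoc]
      split_ifs with h
      · rw [min_eq_right h.le] at ih
        refine (min_le_right _ _).trans ?_
        rw [pow_succ, ← mul_assoc, mul_two]
        exact add_le_add ih le_rfl
      · rw [min_eq_left (not_lt.1 h)] at ih
        simpa using (min_le_left _ _).trans ih
  have key' : ∀ n : ℕ, min x (U * 2 ^ n) ≤ S := fun n =>
    (key n).trans (add_le_add le_rfl (ENNReal.sum_le_tsum _))
  by_contra! hlt
  obtain ⟨n, hn⟩ := ENNReal.exists_nat_mul_gt hU hlt.ne_top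
  have h2 : S < U * 2 ^ n := by
    refine hn.trans_le ?_
    rw [mul_comm]
    gcongr
    exact_mod_cast Nat.lt_two_pow_self.le
  exact (key' n).not_gt (lt_min hlt h2)

/-- Kolmogorov's inequality: the integral over a set of finite measure of a function in weak `L^p`. -/
lemma setLIntegral_le_of_weakType {α : Type*} [MeasurableSpace α] {μ : Measure α} {B : Set α}
    {m : α → ℝ≥0∞} (hm : Measurable m) {U : ℝ≥0∞} (hU0 : U ≠ 0)
    (hU : U ≠ ⊤) {p : ℝ}
    (hweak : ∀ u : ℝ≥0∞, u ≠ ⊤ → u ^ p * μ (B ∩ {z | u < m z}) ≤ U ^ p * μ B) :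
    ∫⁻ z in B, m z ∂μ ≤ (1 + (1 - 2 ^ (1 - p))⁻¹) * U * μ B := by
  have hterm : ∀ k : ℕ, ∫⁻ z in B, (if U * 2 ^ k < m z then U * 2 ^ k else 0) ∂μ ≤
      U * μ B * (2 ^ (1 - p)) ^ k := by
    intro k
    set u : ℝ≥0∞ := U * 2 ^ k
    have hu0 : u ≠ 0 := by simp [u, hU0]
    have hu : u ≠ ⊤ := by finiteness
    have hms : MeasurableSet {z | u < m z} := measurableSet_lt measurable_const hm
    have e1 : ∫⁻ z in B, (if u < m z then u else 0) ∂μ = u * μ (B ∩ {z | u < m z}) := by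
      have : (fun z => if u < m z then u else 0) = {z | u < m z}.indicator fun _ => u := by
        ext z; simp [indicator]
      rw [this, lintegral_indicator_const hms, Measure.restrict_apply hms, inter_comm]
    rw [e1]
    have h := hweak u hu
    have e2 : u = u ^ (1 - p) * u ^ p := by
      rw [← ENNReal.rpow_add _ _ hu0 hu]; simp
    have e3 : u ^ (1 - p) * U ^ p = U * (2 ^ (1 - p)) ^ k := by
      simp only [u]
      rw [ENNReal.mul_rpow_of_ne_top hU (by finiteness), mul_right_comm,
        ← ENNReal.rpow_add _ _ hU0 hU]
      simp only [sub_add_cancel, ENNReal.rpow_one]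
      rw [← ENNReal.rpow_natCast, ← ENNReal.rpow_natCast, ← ENNReal.rpow_mul, ← ENNReal.rpow_mul,
        mul_comm]
      ring_nf
    calc u * μ (B ∩ {z | u < m z}) = u ^ (1 - p) * (u ^ p * μ (B ∩ {z | u < m z})) := by
          rw [← mul_assoc, ← e2]
      _ ≤ u ^ (1 - p) * (U ^ p * μ B) := by gcongr
      _ = _ := by rw [← mul_assoc, e3]; ring
  calc ∫⁻ z in B, m z ∂μ
      ≤ ∫⁻ z in B, (U + ∑' k : ℕ, if U * 2 ^ k < m z then U * 2 ^ k else 0) ∂μ :=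
        lintegral_mono fun z => le_add_tsum_dyadic _ hU0
    _ = U * μ B + ∑' k : ℕ, ∫⁻ z in B, (if U * 2 ^ k < m z then U * 2 ^ k else 0) ∂μ := by
        rw [lintegral_add_left measurable_const, setLIntegral_const, lintegral_tsum]
        exact fun k => (Measurable.ite (measurableSet_lt measurable_const hm) measurable_const
          measurable_const).aemeasurable
    _ ≤ U * μ B + ∑' k : ℕ, U * μ B * (2 ^ (1 - p)) ^ k := by
        gcongr with k; exact hterm k
    _ = _ := by rw [ENNReal.tsum_mul_left, ENNReal.tsum_geometric]; ring

end WeakType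

/-- `f` is `Φ λ`-Lipschitz on pairs of points where the maximal function of `w`, at a scale
comparable to their distance, is at most `λ ^ p`, for each `λ ≥ ε`. -/
def HasPairwiseBound {X : Type*} [MetricSpace X] [MeasurableSpace X] (μ : Measure X) (f : X → ℝ) (w : X → ℝ≥0∞)
    (C₀ p r₀ ε Φ : ℝ) :
    Prop :=
  ∀ (x y : X) (l : ℝ), ε ≤ l → 0 < dist x y → 5 * C₀ * dist x y < r₀ →
    maximalFn μ (2 * (C₀ * dist x y)) w x ≤ ENNReal.ofReal l ^ p →
    maximalFn μ (2 * (C₀ * dist x y)) w y ≤ ENNReal.ofReal l ^ p →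
    dist (f x) (f y) ≤ Φ * l * dist x y

/-! ### Self-improvement of the pairwise bound. -/

section Pointwise

variable {X : Type*} [MetricSpace X] [MeasurableSpace X] [ProperSpace X] [BorelSpace X]
  {μ : Measure X} [IsFiniteMeasureOnCompacts μ]

/-- The maximal function of the indicator of a high superlevel set of a maximal function is small
where the latter is controlled. -/
lemma IsDoublingUpTo.maximalFn_indicator_lt {D r₀ : ℝ} (hD : IsDoublingUpTo μ D r₀)
    (hpos : ∀ (x : X) (r : ℝ), 0 < r → 0 < μ (Metric.ball x r)) {s : ℝ} (hs : 2 * s ≤ r₀)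
    {w : X → ℝ≥0∞} {x : X} {A c θ : ℝ≥0∞} (hc0 : c ≠ 0) (hc : c ≠ ⊤) (hA : A ≠ ⊤)
    (hA2 : ENNReal.ofReal D ^ 2 < A) (hA3 : ENNReal.ofReal D ^ 3 < A * θ)
    (hx : maximalFn μ (2 * s) w x ≤ c) :
    maximalFn μ s ({z | A * c < maximalFn μ s w z}.indicator fun _ => 1) x < θ := by
  set E := {z | A * c < maximalFn μ s w z}
  have hE : MeasurableSet E :=
    ((lowerSemicontinuous_maximalFn hpos s w).isOpen_preimage (A * c)).measurableSet
  have hA0 : A ≠ 0 := (bot_le.trans_lt hA2).ne'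
  refine lt_of_le_of_lt (b := ENNReal.ofReal D ^ 3 / A) (iSup₂_le fun ρ hρ => ?_)
    (ENNReal.div_lt_of_lt_mul' hA3)
  obtain ⟨hρ0, hρs⟩ := hρ
  rw [setLAverage_eq, lintegral_indicator_const hE, one_mul, Measure.restrict_apply hE,
    ENNReal.div_le_iff (hpos x ρ hρ0).ne' (measure_ball_ne_top x ρ)]
  have hweak : A * c * μ (E ∩ Metric.ball x ρ) ≤
      ENNReal.ofReal D ^ 2 * ∫⁻ y in Metric.ball x (2 * ρ), w y ∂μ := by
    refine hD.mul_measure_le_of_forall_exists_ball (T := ρ) (by linarith) ?_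
    rintro z ⟨hzE, hzx⟩
    rw [Metric.mem_ball] at hzx
    obtain ⟨t, ht, hts, hlt⟩ := exists_of_lt_maximalFn hzE
    have htρ : t < ρ := by
      -- If `t ≥ ρ`, then `B(z,t) ⊆ B(x,2t) ⊆ B(z,4t)`, and the control at `x` bounds the average
      -- over `B(z,t)` by `D² c < A c`. So only balls with `t < ρ` matter, and these stay in
      -- `B(x,2ρ)`.
      by_contra! hle
      have h1 : ∫⁻ y in Metric.ball z t, w y ∂μ ≤ ENNReal.ofReal D ^ 2 * c * μ (Metric.ball z t) :=
        calc ∫⁻ y in Metric.ball z t, w y ∂μ ≤ ∫⁻ y in Metric.ball x (2 * t), w y ∂μ :=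
              lintegral_mono_set (Metric.ball_subset_ball' (by linarith))
          _ ≤ c * μ (Metric.ball x (2 * t)) :=
              setLIntegral_ball_le_of_maximalFn_le hpos hx (by linarith) (by linarith)
          _ ≤ c * μ (Metric.ball z (4 * t)) := by
              gcongr
              exact Metric.ball_subset_ball' (by rw [dist_comm]; linarith)
          _ ≤ c * (ENNReal.ofReal D ^ 2 * μ (Metric.ball z t)) := by
              gcongr
              exact hD.measure_ball_four_le z ht (by linarith)
          _ = _ := by ring
      refine (hlt.trans_le h1).not_ge ?_
      gcongr
    exact ⟨t, ht, htρ, Metric.ball_subset_ball' (by linarith), hlt.le⟩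
  have h2 : A * c * μ (E ∩ Metric.ball x ρ) ≤ c * (ENNReal.ofReal D ^ 3 * μ (Metric.ball x ρ)) :=
    calc _ ≤ _ := hweak
      _ ≤ ENNReal.ofReal D ^ 2 * (c * μ (Metric.ball x (2 * ρ))) := by
          gcongr
          exact setLIntegral_ball_le_of_maximalFn_le hpos hx (by linarith) (by linarith)
      _ ≤ ENNReal.ofReal D ^ 2 * (c * (ENNReal.ofReal D * μ (Metric.ball x ρ))) := by
          gcongr
          exact (hD x ρ hρ0 (by linarith)).2
      _ = _ := by ring
  rw [mul_comm A c, mul_assoc, ENNReal.mul_le_mul_iff_right hc0 hc] at h2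
  rw [← ENNReal.mul_div_right_comm, ENNReal.le_div_iff_mul_le (Or.inl hA0) (Or.inl hA), mul_comm]
  exact h2

/-- Following the curve turns the bound with `Φ` into one with `C₀ A^{1/p} + Φ/2`: the old bound is
only used across the gaps in `E`, at the higher level `A^{1/p} l`, and `hδA` says that the smallness
of the gaps more than pays for that level. -/
lemma HasPairwiseBound.improve {p C₀ τ δ D r₀ A ε Φ : ℝ} (hp : 1 < p) (hC₀ : 1 ≤ C₀)
    (hδ : 0 < δ) (hτ : 0 < τ) (hD : IsDoublingUpTo μ D r₀)
    (hpos : ∀ (x : X) (r : ℝ), 0 < r → 0 < μ (Metric.ball x r))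
    (hconn : IsMaxConnectedAtLevel μ C₀ δ τ p r₀) (hA : 1 ≤ A)
    (hA2 : ENNReal.ofReal D ^ 2 < ENNReal.ofReal A)
    (hA3 : ENNReal.ofReal D ^ 3 < ENNReal.ofReal A * ENNReal.ofReal τ)
    (hδA : δ * τ ^ (1 / p) * A ^ (1 / p) ≤ 1 / 2) (hε : 0 < ε) (hΦ : 0 ≤ Φ)
    {f : X → ℝ} {K : ℝ≥0} (hf : LipschitzWith K f) {w : X → ℝ≥0∞} (hw : LowerSemicontinuous w)
    (hfw : ∀ z, lipConst f z ^ p ≤ w z) (h : HasPairwiseBound μ f w C₀ p r₀ ε Φ) :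
    HasPairwiseBound μ f w C₀ p r₀ ε (C₀ * A ^ (1 / p) + Φ / 2) := by
  intro x y l hl hr hr₀ hx hy
  set r := dist x y
  have hp0 : 0 < p := by linarith
  have hl0 : 0 < l := hε.trans_le hl
  have hC₀r : r ≤ C₀ * r := le_mul_of_one_le_left hr.le hC₀
  set a := A ^ (1 / p) * l
  have hA1 : 1 ≤ A ^ (1 / p) := Real.one_le_rpow hA (by positivity)
  have ha : l ≤ a := le_mul_of_one_le_left hl0.le hA1
  have ha0 : 0 < a := hl0.trans_le ha
  set c := ENNReal.ofReal l ^ p with hc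
  have hac : ENNReal.ofReal a ^ p = ENNReal.ofReal A * c := by
    rw [hc, ENNReal.ofReal_rpow_of_pos ha0, ENNReal.ofReal_rpow_of_pos hl0,
      ← ENNReal.ofReal_mul (by linarith), Real.mul_rpow (by positivity) hl0.le,
      ← Real.rpow_mul (by linarith), one_div_mul_cancel hp0.ne', Real.rpow_one]
  have hc0 : c ≠ 0 := by
    rw [hc, ENNReal.ofReal_rpow_of_pos hl0]
    exact (ENNReal.ofReal_pos.2 (by positivity)).ne'
  have hct : c ≠ ⊤ := by rw [hc, ENNReal.ofReal_rpow_of_pos hl0]; exact ENNReal.ofReal_ne_top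
  have hcA : c ≤ ENNReal.ofReal A * c := le_mul_of_one_le_left' (by simpa using hA)
  set E := {z | ENNReal.ofReal A * c < maximalFn μ (C₀ * r) w z}
  have hEo : IsOpen E := (lowerSemicontinuous_maximalFn hpos (C₀ * r) w).isOpen_preimage _
  have hxE : x ∉ E := not_lt.2
    ((maximalFn_mono_radius (by linarith) w x).trans (hx.trans hcA))
  have hyE : y ∉ E := not_lt.2
    ((maximalFn_mono_radius (by linarith) w y).trans (hy.trans hcA))
  obtain ⟨L, γ, hL, hγ, h0, h1, hlen, hpath⟩ := hconn x y hr (by nlinarith) E hEo.measurableSet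
    (hD.maximalFn_indicator_lt hpos (by linarith) hc0 hct ENNReal.ofReal_ne_top hA2 hA3 hx)
    (hD.maximalFn_indicator_lt hpos (by linarith) hc0 hct ENNReal.ofReal_ne_top hA2 hA3 hy)
  have hδτ : 0 < δ * τ ^ (1 / p) := by positivity
  have hδ2 : δ * τ ^ (1 / p) ≤ 1 / 2 := (le_mul_of_one_le_right hδτ.le hA1).trans hδA
  have key := edist_comp_endpoints_le hf hL hγ hEo (h0.symm ▸ hxE) (h1.symm ▸ hyE)
    (G := ENNReal.ofReal a) (H := ENNReal.ofReal (Φ * a)) ENNReal.ofReal_ne_top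
    ENNReal.ofReal_ne_top (fun z hz => ?_) (fun u hu v hv huv => ?_)
  · rw [h0, h1] at key
    have key' : edist (f x) (f y) ≤ ENNReal.ofReal
        (a * (C₀ * r) + Φ * a * (δ * τ ^ (1 / p) * r)) := by
      rw [ENNReal.ofReal_add (by positivity) (by positivity), ENNReal.ofReal_mul ha0.le,
        ENNReal.ofReal_mul (p := Φ * a) (by positivity)]
      refine key.trans ?_
      gcongr
    rw [edist_dist, ENNReal.ofReal_le_ofReal_iff (by positivity)] at key'
    refine key'.trans ?_
    have : Φ * a * (δ * τ ^ (1 / p) * r) = Φ * l * r * (δ * τ ^ (1 / p) * A ^ (1 / p)) := by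
      simp only [a]; ring
    rw [this]
    have h3 : Φ * l * r * (δ * τ ^ (1 / p) * A ^ (1 / p)) ≤ Φ * l * r * (1 / 2) := by gcongr
    have h4 : (C₀ * A ^ (1 / p) + Φ / 2) * l * r = a * (C₀ * r) + Φ * l * r * (1 / 2) := by
      simp only [a]; ring
    linarith
  · have h2 : lipConst f z ^ p ≤ ENNReal.ofReal a ^ p :=
      hac ▸ (hfw z).trans ((le_maximalFn_of_lowerSemicontinuous hpos (by positivity) hw z).trans
        (not_lt.1 hz))
    exact (ENNReal.rpow_le_rpow_iff hp0).1 h2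
  · rcases eq_or_ne u v with rfl | hne
    · simp
    have hd : dist u v ≤ δ * τ ^ (1 / p) * r := by
      have := huv.trans hpath
      rwa [edist_dist, ENNReal.ofReal_le_ofReal_iff (by positivity)] at this
    have hd2 : dist u v ≤ r / 2 := hd.trans (by nlinarith)
    have hd3 : C₀ * dist u v ≤ C₀ * (r / 2) := by gcongr
    -- Since `d(u,v) ≤ r/2`, the radius `2C₀d(u,v)` is at most `C₀r`, the one used to define `E`;
    -- this is why the pairwise bound carries the factor 2.
    have h2 := h u v a (hl.trans ha) (dist_pos.2 hne) (by linarith)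
      (hac ▸ (maximalFn_mono_radius (by linarith) w u).trans (not_lt.1 hu))
      (hac ▸ (maximalFn_mono_radius (by linarith) w v).trans (not_lt.1 hv))
    rw [edist_dist, edist_dist, ← ENNReal.ofReal_mul (by positivity)]
    exact ENNReal.ofReal_le_ofReal h2

/-- The pointwise estimate behind the Poincaré inequality. -/
lemma hasPairwiseBound_of_isMaxConnectedAtLevel {p C₀ τ δ D r₀ A : ℝ} (hp : 1 < p) (hC₀ : 1 ≤ C₀)
    (hδ : 0 < δ) (hτ : 0 < τ) (hD : IsDoublingUpTo μ D r₀)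
    (hpos : ∀ (x : X) (r : ℝ), 0 < r → 0 < μ (Metric.ball x r))
    (hconn : IsMaxConnectedAtLevel μ C₀ δ τ p r₀) (hA : 1 ≤ A)
    (hA2 : ENNReal.ofReal D ^ 2 < ENNReal.ofReal A)
    (hA3 : ENNReal.ofReal D ^ 3 < ENNReal.ofReal A * ENNReal.ofReal τ)
    (hδA : δ * τ ^ (1 / p) * A ^ (1 / p) ≤ 1 / 2) {ε : ℝ} (hε : 0 < ε)
    {f : X → ℝ} {K : ℝ≥0} (hf : LipschitzWith K f) {w : X → ℝ≥0∞} (hw : LowerSemicontinuous w)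
    (hfw : ∀ z, lipConst f z ^ p ≤ w z) :
    HasPairwiseBound μ f w C₀ p r₀ ε (2 * C₀ * A ^ (1 / p)) := by
  have hA0 : 0 ≤ A ^ (1 / p) := Real.rpow_nonneg (by linarith) _
  have hn : ∀ n : ℕ, HasPairwiseBound μ f w C₀ p r₀ ε
      (2 * C₀ * A ^ (1 / p) + K / ε * (1 / 2) ^ n) := by
    intro n
    induction n with
    | zero =>
      intro x y l hl hr _ _ _
      -- The iteration can start because levels are bounded below by `ε`: the Lipschitz bound of `f`
      -- is then a pairwise bound with constant `K / ε`.
      have h1 : (K : ℝ) ≤ K / ε * l := by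
        rw [div_mul_eq_mul_div, le_div_iff₀ hε]; gcongr
      have h2 : 0 ≤ 2 * C₀ * A ^ (1 / p) * l := by
        have := hε.trans_le hl
        positivity
      refine (hf.dist_le_mul x y).trans ?_
      gcongr
      linarith
    | succ n ih =>
      have := ih.improve hp hC₀ hδ hτ hD hpos hconn hA hA2 hA3 hδA hε (by positivity) hf hw hfw
      convert this using 1
      ring
  intro x y l hl hr hr₀ hx hy
  refine ge_of_tendsto (x := atTop)
    (f := fun n : ℕ => (2 * C₀ * A ^ (1 / p) + K / ε * (1 / 2) ^ n) * l * dist x y) ?_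
    (Eventually.of_forall fun n => hn n x y l hl hr hr₀ hx hy)
  have := tendsto_pow_atTop_nhds_zero_of_lt_one (r := (1 / 2 : ℝ)) (by norm_num) (by norm_num)
  simpa using (((this.const_mul (K / ε : ℝ)).const_add (2 * C₀ * A ^ (1 / p))).mul_const l).mul_const
    (dist x y)

end Pointwise

/-! ### From pairwise bounds to mean oscillation. -/

lemma lintegral_enorm_sub_integral_le {α : Type*} [MeasurableSpace α] {P : Measure α}
    [IsProbabilityMeasure P] {f : α → ℝ} (hf : Integrable f P) {m : α → ℝ≥0∞} (hm : Measurable m)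
    {c : ℝ≥0∞} (h : ∀ᵐ y ∂P, ∀ᵐ z ∂P, ‖f y - f z‖ₑ ≤ c * (m y + m z)) :
    ∫⁻ y, ‖f y - ∫ z, f z ∂P‖ₑ ∂P ≤ 2 * c * ∫⁻ y, m y ∂P := by
  calc ∫⁻ y, ‖f y - ∫ z, f z ∂P‖ₑ ∂P ≤ ∫⁻ y, c * (m y + ∫⁻ z, m z ∂P) ∂P := by
        refine lintegral_mono_ae ?_
        filter_upwards [h] with y hy
        have e : f y - ∫ z, f z ∂P = ∫ z, (f y - f z) ∂P := by
          rw [integral_sub (integrable_const _) hf]; simp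
        rw [e]
        calc _ ≤ ∫⁻ z, ‖f y - f z‖ₑ ∂P := enorm_integral_le_lintegral_enorm _
          _ ≤ ∫⁻ z, c * (m y + m z) ∂P := lintegral_mono_ae hy
          _ = _ := by
            rw [lintegral_const_mul _ (hm.const_add _),
              lintegral_add_left measurable_const]
            simp
    _ = _ := by
        rw [lintegral_const_mul _ (hm.add_const _), lintegral_add_right _ measurable_const]
        simp
        ring

/-- The constant in Kolmogorov's inequality. -/
noncomputable def kolmogorovConst (p : ℝ) : ℝ≥0∞ := 1 + (1 - 2 ^ (1 - p))⁻¹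

lemma kolmogorovConst_ne_top {p : ℝ} (hp : 1 < p) : kolmogorovConst p ≠ ⊤ := by
  have : (2 : ℝ≥0∞) ^ (1 - p) < 1 :=
    ENNReal.rpow_lt_one_of_one_lt_of_neg (by norm_num) (by linarith)
  exact ENNReal.add_ne_top.2 ⟨ENNReal.one_ne_top, ENNReal.inv_ne_top.2 (tsub_pos_of_lt this).ne'⟩

/-- Use the level `s + η`, with `s` the sum of the two roots: it dominates both, and `η > 0` keeps
it above the threshold `ε = η` even when `s = 0`. Then `η` tends to 0. -/
lemma HasPairwiseBound.enorm_sub_le {X : Type*} [MetricSpace X] [MeasurableSpace X]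
    {μ : Measure X} {p C₀ r₀ Φ : ℝ} (hp : 0 < p) (hC₀ : 1 ≤ C₀) (hΦ : 0 < Φ)
    {f : X → ℝ} {w : X → ℝ≥0∞} (h : ∀ ε > 0, HasPairwiseBound μ f w C₀ p r₀ ε Φ) {x₀ : X} {R : ℝ}
    (hR : 0 < R) (hRr₀ : 10 * C₀ * R < r₀) {x y : X} (hx : x ∈ Metric.ball x₀ R)
    (hy : y ∈ Metric.ball x₀ R) :
    ‖f x - f y‖ₑ ≤ ENNReal.ofReal (Φ * (2 * R)) *
      (maximalFn μ (4 * C₀ * R) w x ^ (1 / p) + maximalFn μ (4 * C₀ * R) w y ^ (1 / p)) := by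
  rcases eq_or_ne x y with rfl | hne
  · simp
  have hd0 : 0 < dist x y := dist_pos.2 hne
  have hdR : dist x y < 2 * R := by
    rw [Metric.mem_ball] at hx hy
    linarith [dist_triangle_right x y x₀]
  have hC₀d : C₀ * dist x y ≤ C₀ * (2 * R) := by gcongr
  have hΦR : 0 < Φ * (2 * R) := by positivity
  set s := maximalFn μ (4 * C₀ * R) w x ^ (1 / p) + maximalFn μ (4 * C₀ * R) w y ^ (1 / p) with hs
  rcases eq_or_ne s ⊤ with htop | htop
  · rw [htop, ENNReal.mul_top (ENNReal.ofReal_pos.2 hΦR).ne']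
    exact le_top
  have hbound : ∀ {η : ℝ}, 0 < η → ∀ {z : X}, maximalFn μ (4 * C₀ * R) w z ^ (1 / p) ≤ s →
      maximalFn μ (2 * (C₀ * dist x y)) w z ≤ ENNReal.ofReal (s.toReal + η) ^ p := by
    intro η hη z hz
    refine (maximalFn_mono_radius (t := 4 * C₀ * R) (by linarith) w z).trans ?_
    have h1 : s ≤ ENNReal.ofReal (s.toReal + η) :=
      (ENNReal.ofReal_toReal htop).symm.le.trans (ENNReal.ofReal_le_ofReal (by linarith))
    have h2 := ENNReal.rpow_le_rpow (hz.trans h1) hp.le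
    rwa [← ENNReal.rpow_mul, one_div_mul_cancel hp.ne', ENNReal.rpow_one] at h2
  have key : dist (f x) (f y) ≤ Φ * (2 * R) * s.toReal := by
    refine le_of_forall_pos_le_add fun ε' hε' => ?_
    have hη : 0 < ε' / (Φ * (2 * R)) := by positivity
    have hsη : 0 < s.toReal + ε' / (Φ * (2 * R)) := by positivity
    have := h _ hη x y (s.toReal + ε' / (Φ * (2 * R))) (by simp) hd0 (by linarith)
      (hbound hη le_self_add) (hbound hη le_add_self)
    calc dist (f x) (f y) ≤ _ := this
      _ ≤ Φ * (s.toReal + ε' / (Φ * (2 * R))) * (2 * R) := by gcongr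
      _ = _ := by field_simp
  rw [← edist_eq_enorm_sub, edist_dist]
  refine (ENNReal.ofReal_le_ofReal key).trans ?_
  rw [ENNReal.ofReal_mul hΦR.le, ENNReal.ofReal_toReal htop]

/-! ### The Poincaré inequality. -/

section Poincare

variable {X : Type*} [MetricSpace X] [MeasurableSpace X] [ProperSpace X] [BorelSpace X]
  {μ : Measure X} [IsFiniteMeasureOnCompacts μ]

lemma IsDoublingUpTo.setLAverage_maximalFn_rpow_le {D r₀ : ℝ} (hD : IsDoublingUpTo μ D r₀)
    (hD1 : 1 ≤ D) (hpos : ∀ (x : X) (r : ℝ), 0 < r → 0 < μ (Metric.ball x r)) {p C₀ : ℝ}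
    (hp : 1 < p) (hC₀ : 1 ≤ C₀) {w : X → ℝ≥0∞} {x₀ : X} {R : ℝ} (hR : 0 < R)
    (hRr₀ : 10 * C₀ * R < r₀) {N : ℝ≥0∞} (hN0 : N ≠ 0) (hN : N ≠ ⊤)
    (hw : ∫⁻ z in Metric.ball x₀ (10 * C₀ * R), w z ∂μ ≤ N) :
    ⨍⁻ z in Metric.ball x₀ R, maximalFn μ (4 * C₀ * R) w z ^ (1 / p) ∂μ ≤
      kolmogorovConst p * (ENNReal.ofReal D ^ 2 * N / μ (Metric.ball x₀ R)) ^ (1 / p) := by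
  have hp0 : 0 < p := by linarith
  set B := Metric.ball x₀ R
  have hB0 : μ B ≠ 0 := (hpos x₀ R hR).ne'
  have hB : μ B ≠ ⊤ := measure_ball_ne_top x₀ R
  have hD0 : ENNReal.ofReal D ≠ 0 := (ENNReal.ofReal_pos.2 (by linarith)).ne'
  set V := ENNReal.ofReal D ^ 2 * N / μ B
  have hV0 : V ≠ 0 := ENNReal.div_ne_zero.2 ⟨mul_ne_zero (pow_ne_zero _ hD0) hN0, hB⟩
  have hV : V ≠ ⊤ := ENNReal.div_ne_top (by finiteness) hB0
  have hVB : V * μ B = ENNReal.ofReal D ^ 2 * N := ENNReal.div_mul_cancel hB0 hB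
  rw [setLAverage_eq, ENNReal.div_le_iff hB0 hB]
  refine setLIntegral_le_of_weakType
    ((lowerSemicontinuous_maximalFn hpos _ w).measurable.pow_const _) ?_ ?_ fun u _ => ?_
  · exact (ENNReal.rpow_pos (pos_iff_ne_zero.2 hV0) hV).ne'
  · exact ENNReal.rpow_ne_top_of_nonneg (by positivity) hV
  · rw [← ENNReal.rpow_mul, one_div_mul_cancel hp0.ne', ENNReal.rpow_one, hVB]
    -- Balls of radius below `4C₀R` centered in `B(x₀,R)` stay in `B(x₀,10C₀R)`, as `4C₀R + R ≤
    -- 10C₀R`.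
    refine (hD.mul_measure_le_of_forall_exists_ball (T := 4 * C₀ * R)
      (U := Metric.ball x₀ (10 * C₀ * R)) (g := w) (by nlinarith) ?_).trans (by gcongr)
    rintro z ⟨hzB, hz⟩
    have hz' : u ^ p < maximalFn μ (4 * C₀ * R) w z := by
      have := ENNReal.rpow_lt_rpow hz hp0
      rwa [← ENNReal.rpow_mul, one_div_mul_cancel hp0.ne', ENNReal.rpow_one] at this
    obtain ⟨t, ht, htT, hlt⟩ := exists_of_lt_maximalFn hz'
    refine ⟨t, ht, htT, Metric.ball_subset_ball' ?_, hlt.le⟩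
    rw [Metric.mem_ball] at hzB
    nlinarith

/-- The Poincaré inequality, with the constant in terms of `Φ`, follows from the pairwise bounds. -/
lemma IsDoublingUpTo.poincare_of_hasPairwiseBound {D r₀ : ℝ} (hD : IsDoublingUpTo μ D r₀)
    (hD1 : 1 ≤ D) (hpos : ∀ (x : X) (r : ℝ), 0 < r → 0 < μ (Metric.ball x r)) {p C₀ Φ : ℝ}
    (hp : 1 < p) (hC₀ : 1 ≤ C₀) (hΦ : 0 < Φ) {f : X → ℝ} {K : ℝ≥0} (hf : LipschitzWith K f)
    (h : ∀ w : X → ℝ≥0∞, LowerSemicontinuous w → (∀ z, lipConst f z ^ p ≤ w z) →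
      ∀ ε > 0, HasPairwiseBound μ f w C₀ p r₀ ε Φ)
    {x₀ : X} {R : ℝ} (hR : 0 < R) (hRr₀ : 10 * C₀ * R < r₀) {k : ℕ} (hk : 10 * C₀ ≤ 2 ^ k) :
    ⨍⁻ y in Metric.ball x₀ R, ‖f y - ⨍ z in Metric.ball x₀ R, f z ∂μ‖ₑ ∂μ ≤
      2 * ENNReal.ofReal (Φ * (2 * R)) * (kolmogorovConst p * (ENNReal.ofReal D ^ (k + 2) *
        ⨍⁻ y in Metric.ball x₀ (10 * C₀ * R), lipConst f y ^ p ∂μ) ^ (1 / p)) := by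
  have hp0 : 0 < p := by linarith
  set B := Metric.ball x₀ R
  set U := Metric.ball x₀ (10 * C₀ * R)
  have hB0 : μ B ≠ 0 := (hpos x₀ R hR).ne'
  have hB : μ B ≠ ⊤ := measure_ball_ne_top x₀ R
  have hU0 : μ U ≠ 0 := (hpos x₀ _ (by positivity)).ne'
  have hU : μ U ≠ ⊤ := measure_ball_ne_top x₀ _
  have hUB : μ U ≤ ENNReal.ofReal D ^ k * μ B := by
    refine (hD.measure_ball_le_pow x₀ (by positivity) hRr₀.le k).trans ?_
    gcongr
    refine Metric.ball_subset_ball ?_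
    rw [div_le_iff₀ (by positivity), mul_comm]
    gcongr
  have hinv : (μ B)⁻¹ ≤ ENNReal.ofReal D ^ k / μ U := by
    rw [ENNReal.le_div_iff_mul_le (Or.inl hU0) (Or.inl hU), mul_comm, ← div_eq_mul_inv]
    exact ENNReal.div_le_of_le_mul hUB
  set J := ∫⁻ y in U, lipConst f y ^ p ∂μ
  have hJ : J ≠ ⊤ := by
    refine ne_top_of_le_ne_top (b := (K : ℝ≥0∞) ^ p * μ U)
      (ENNReal.mul_ne_top (ENNReal.rpow_ne_top_of_nonneg hp0.le ENNReal.coe_ne_top) hU) ?_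
    rw [← setLIntegral_const]
    exact lintegral_mono fun z => ENNReal.rpow_le_rpow (lipConst_le hf z) hp0.le
  have : IsFiniteMeasure (μ.restrict U) := ⟨by simpa using measure_ball_lt_top⟩
  have hint : IntegrableOn f B μ :=
    (hf.continuous.continuousOn.integrableOn_compact (isCompact_closedBall x₀ R)).mono_set
      Metric.ball_subset_closedBall
  have : IsProbabilityMeasure ((μ B)⁻¹ • μ.restrict B) :=
    ⟨by simp [ENNReal.inv_mul_cancel hB0 hB]⟩
  have key : ∀ ε : ℝ≥0∞, 0 < ε → ε < 1 →
      ⨍⁻ y in B, ‖f y - ⨍ z in B, f z ∂μ‖ₑ ∂μ ≤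
      2 * ENNReal.ofReal (Φ * (2 * R)) * (kolmogorovConst p * (ENNReal.ofReal D ^ (k + 2) *
        (J / μ U + ε)) ^ (1 / p)) := by
    intro ε hε hε1
    have hεU : ε * μ U ≠ 0 := mul_ne_zero hε.ne' hU0
    -- Vitali–Carathéodory: `w` majorizes `Lip[f]^p` everywhere, at an extra cost `ε * μ U` in the
    -- integral over `U`. The constant in `hpair` does not depend on `w`, so `ε` can tend to 0 at
    -- the end.
    obtain ⟨w, hw1, hw2, hw3⟩ := exists_le_lowerSemicontinuous_lintegral_ge (μ.restrict U)
      (fun z => lipConst f z ^ p) ((measurable_lipConst hf.continuous).pow_const p) hεU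
    have hpair := h w hw2 hw1
    set m : X → ℝ≥0∞ := fun z => maximalFn μ (4 * C₀ * R) w z ^ (1 / p)
    have hm : Measurable m := (lowerSemicontinuous_maximalFn hpos _ w).measurable.pow_const _
    have hmemB : ∀ᵐ y ∂((μ B)⁻¹ • μ.restrict B), y ∈ B :=
      Measure.ae_smul_measure (ae_restrict_mem measurableSet_ball) _
    have h1 := lintegral_enorm_sub_integral_le (P := (μ B)⁻¹ • μ.restrict B) (f := f)
      (hint.smul_measure (ENNReal.inv_ne_top.2 hB0)) hm
      (c := ENNReal.ofReal (Φ * (2 * R))) (by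
        filter_upwards [hmemB] with y hy
        filter_upwards [hmemB] with z hz
        exact HasPairwiseBound.enorm_sub_le hp0 hC₀ hΦ hpair hR hRr₀ hy hz)
    rw [setLAverage_eq', setAverage_eq']
    refine h1.trans ?_
    rw [← setLAverage_eq']
    gcongr
    refine (hD.setLAverage_maximalFn_rpow_le hD1 hpos hp hC₀ hR hRr₀ (N := J + ε * μ U)
      (by simp [hεU]) (by finiteness) hw3).trans ?_
    gcongr
    calc ENNReal.ofReal D ^ 2 * (J + ε * μ U) / μ B
        = ENNReal.ofReal D ^ 2 * (J + ε * μ U) * (μ B)⁻¹ := div_eq_mul_inv _ _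
      _ ≤ ENNReal.ofReal D ^ 2 * (J + ε * μ U) * (ENNReal.ofReal D ^ k / μ U) := by gcongr
      _ = ENNReal.ofReal D ^ (k + 2) * ((J + ε * μ U) / μ U) := by
          simp only [div_eq_mul_inv]; ring
      _ = _ := by
          rw [ENNReal.add_div, ENNReal.mul_div_cancel_right hU0 hU]
  have hJU : ⨍⁻ y in U, lipConst f y ^ p ∂μ = J / μ U := by rw [setLAverage_eq]
  rw [hJU]
  have hlim : Tendsto (fun ε : ℝ≥0∞ => 2 * ENNReal.ofReal (Φ * (2 * R)) *
      (kolmogorovConst p * (ENNReal.ofReal D ^ (k + 2) * (J / μ U + ε)) ^ (1 / p)))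
      (𝓝[>] 0) (𝓝 (2 * ENNReal.ofReal (Φ * (2 * R)) *
      (kolmogorovConst p * (ENNReal.ofReal D ^ (k + 2) * (J / μ U + 0)) ^ (1 / p)))) := by
    refine tendsto_nhdsWithin_of_tendsto_nhds ?_
    refine ENNReal.Tendsto.const_mul ?_ (Or.inr (by finiteness))
    refine ENNReal.Tendsto.const_mul ?_ (Or.inr (kolmogorovConst_ne_top hp))
    refine (ENNReal.continuous_rpow_const.tendsto _).comp ?_
    refine ENNReal.Tendsto.const_mul ?_ (Or.inr (by finiteness))
    exact tendsto_const_nhds.add tendsto_id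
  rw [add_zero] at hlim
  refine ge_of_tendsto hlim ?_
  filter_upwards [Ioo_mem_nhdsGT (zero_lt_one (α := ℝ≥0∞))] with ε hε using key ε hε.1 hε.2

end Poincare

end MaxConn

/-! ### Choice of constants and conclusion. -/

open MaxConn in
theorem mainTheorem5 :
    ∀ p C₀ τ₀ δ : ℝ, 1 < p → 1 ≤ C₀ → 0 < τ₀ → τ₀ < 1 → 0 < δ →
      ∃ C₁ : ℝ, 1 ≤ C₁ ∧
        ∀ D r₀ : ℝ, 1 ≤ D → 0 < r₀ → δ < 1 / 2 * D ^ (-5 / p) →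
          ∀ (X : Type*) [MetricSpace X] [ProperSpace X] [MeasurableSpace X] [BorelSpace X]
            (μ : Measure X) [μ.Regular],
            MaxConn.IsDoublingUpTo μ D r₀ →
            MaxConn.IsMaxConnectedAtLevel μ C₀ δ τ₀ p r₀ →
            MaxConn.HasPoincareInequality μ p C₁ (10 * C₀) (r₀ / (10 * C₀)) := by
  intro p C₀ τ₀ δ hp hC₀ hτ₀ hτ₁ hδ
  have hp0 : 0 < p := by linarith
  obtain ⟨k, hk⟩ := pow_unbounded_of_one_lt (10 * C₀) (one_lt_two (α := ℝ))
  -- The hypothesis on `δ` amounts to `D ^ 5 < Q`. Since `Q` involves only `δ` and `p`, replacing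
  -- `D` by `Q` frees the final constant from `D`.
  set Q : ℝ := (2 * δ) ^ (-p) with hQ
  have hQ0 : 0 < Q := by positivity
  -- This choice gives `δ τ₀^{1/p} A^{1/p} = 1/2` exactly, while `A ≥ Q > D²` and `A τ₀ = Q > D³`.
  set A : ℝ := Q / τ₀ with hA
  have hA0 : 0 < A := by positivity
  set Φ : ℝ := 2 * C₀ * A ^ (1 / p)
  have hΦ : 0 < Φ := by positivity
  set S : ℝ := (kolmogorovConst p).toReal
  refine ⟨max 1 (2 * (Φ * 2) * (S * (Q ^ (k + 2)) ^ (1 / p))), le_max_left _ _, ?_⟩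
  intro D r₀ hD1 hr₀ hδD X _ _ _ _ μ _ hD hconn f ⟨K, hf⟩ x₀ R hR hRr₀
  have hpos := fun (x : X) (r : ℝ) (hr : 0 < r) => hD.measure_ball_pos hr₀ x hr
  have hD0 : 0 < D := by linarith
  have hDQ : D ^ 5 < Q := by
    have h1 : (D ^ (-5 / p)) ^ (-p) < (2 * δ) ^ (-p) :=
      Real.rpow_lt_rpow_of_neg (by positivity) (by linarith) (by linarith)
    rw [← Real.rpow_mul hD0.le, show -5 / p * -p = (5 : ℕ) by push_cast; field_simp,
      Real.rpow_natCast] at h1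
    exact h1
  have hDpow : ∀ {i j : ℕ}, i ≤ j → D ^ i ≤ D ^ j := fun h => pow_le_pow_right₀ hD1 h
  have hDQ1 : D ≤ Q := by
    have := hDpow (i := 1) (j := 5) (by norm_num)
    rw [pow_one] at this; linarith
  have hAτ : A * τ₀ = Q := div_mul_cancel₀ _ hτ₀.ne'
  have hQA : Q ≤ A := by rw [← hAτ]; exact mul_le_of_le_one_right hA0.le hτ₁.le
  have hA2 : ENNReal.ofReal D ^ 2 < ENNReal.ofReal A := by
    rw [← ENNReal.ofReal_pow hD0.le, ENNReal.ofReal_lt_ofReal_iff hA0]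
    linarith [hDpow (i := 2) (j := 5) (by norm_num)]
  have hA3 : ENNReal.ofReal D ^ 3 < ENNReal.ofReal A * ENNReal.ofReal τ₀ := by
    rw [← ENNReal.ofReal_pow hD0.le, ← ENNReal.ofReal_mul hA0.le, hAτ,
      ENNReal.ofReal_lt_ofReal_iff hQ0]
    linarith [hDpow (i := 3) (j := 5) (by norm_num)]
  have hδA : δ * τ₀ ^ (1 / p) * A ^ (1 / p) ≤ 1 / 2 := by
    rw [mul_assoc, ← Real.mul_rpow hτ₀.le hA0.le, mul_comm τ₀, hAτ, hQ, ← Real.rpow_mul (by positivity),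
      show -p * (1 / p) = -1 by field_simp, Real.rpow_neg_one]
    apply le_of_eq
    field_simp
  have hRr₀' : 10 * C₀ * R < r₀ := by
    rw [lt_div_iff₀ (by positivity)] at hRr₀
    linarith
  have hmain := hD.poincare_of_hasPairwiseBound hD1 hpos hp hC₀ hΦ hf
    (fun w hw hfw ε hε => hasPairwiseBound_of_isMaxConnectedAtLevel hp hC₀ hδ hτ₀ hD hpos hconn
      (by linarith) hA2 hA3 hδA hε hf hw hfw) hR (x₀ := x₀) hRr₀' hk.le
  refine hmain.trans ?_
  set I := ⨍⁻ y in Metric.ball x₀ (10 * C₀ * R), lipConst f y ^ p ∂μ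
  have hS : kolmogorovConst p = ENNReal.ofReal S :=
    (ENNReal.ofReal_toReal (kolmogorovConst_ne_top hp)).symm
  calc 2 * ENNReal.ofReal (Φ * (2 * R)) * (kolmogorovConst p *
        (ENNReal.ofReal D ^ (k + 2) * I) ^ (1 / p))
      ≤ 2 * ENNReal.ofReal (Φ * (2 * R)) * (kolmogorovConst p *
        (ENNReal.ofReal Q ^ (k + 2) * I) ^ (1 / p)) := by gcongr
    _ = ENNReal.ofReal (2 * (Φ * 2) * (S * (Q ^ (k + 2)) ^ (1 / p)) * R) * I ^ (1 / p) := by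
        rw [ENNReal.mul_rpow_of_nonneg _ _ (by positivity), hS, ← ENNReal.ofReal_pow hQ0.le,
          ENNReal.ofReal_rpow_of_pos (by positivity),
          show (2 : ℝ≥0∞) = ENNReal.ofReal 2 by simp, ← ENNReal.ofReal_mul (by norm_num),
          ← mul_assoc, ← mul_assoc, ← ENNReal.ofReal_mul (by positivity),
          ← ENNReal.ofReal_mul (by positivity)]
        congr 2
        ring
    _ ≤ _ := by
        gcongr
        exact le_max_right _ _
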